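/- Conventions. A monoid $M$ is atomic if it is generated by its atoms (elements $a\neq 1$ such that $a=bc$ implies $b=1$ or $c=1$) and if for each $a\in M$ the lengths of the expressions of $a$ as a product of atoms are bounded. Write $a\le_L b$ if $b\in aM$ and $a\le_R b$ if $b\in Ma$. A Garside monoid is an atomic, finitely generated, left and right cancellative monoid $M$ for which $(M,\le_L)$ and $(M,\le_R)$ are lattices and which has a Garside element, that is, an element $\Delta$ whose sets of left and right divisors coincide and generate $M$. A Garside group $G$ is the group of fractions of a Garside monoid $G^+$, its positive monoid. For $g,h\in G$ put $g\le_L h$ if $g^{-1}h\in G^+$. Fix a Garside element $\Delta$ and let $\tau(g)=\Delta^{-1}g\Delta$, $\inf(g)=\max\{r\in\mathbb Z:\Delta^r\le_L g\}$, $\sup(g)=\min\{s\in\mathbb Z: g\le_L\Delta^s\}$. The normal form of $g$ is $g=\Delta^r s_1\cdots s_k$ with left divisors $s_i\notin\{1,\Delta\}$ of $\Delta$ in $G^+$ such that $(s_i\cdots s_k)\wedge_L\Delta=s_i$ for all $i$, where $\wedge_L$ is the greatest common divisor for $\le_L$. The cycling of $g$ is $\mathbf c(g)=\Delta^r s_2\cdots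 s_k\,\tau^{-r}(s_1)$ (and $\mathbf c(g)=g$ if $k=0$). The super summit set $[g]^S$ is the set of conjugates of $g$ at which $\inf$ attains its maximum over the conjugacy class of $g$ and $\sup$ attains its minimum over it; the ultra summit set is $[g]^U=\{h\in[g]^S:\mathbf c^k(h)=h\text{ for some }k>0\}$. For $n\ge 1$ let $G(n)=\mathbb Z\ltimes G^n$, where $\mathbb Z=\langle\delta\rangle$ acts on $G^n$ on the right by $(g_1,\ldots,g_n)^\delta=(g_n,g_1,\ldots,g_{n-1})$; its elements are written $\delta^k(g_1,\ldots,g_n)$, and the product is $\delta^k x\cdot\delta^m y=\delta^{k+m}\,(x^{\delta^m}y)$ for $x,y\in G^n$. It is a Garside group with positive monoid $\{\delta^k(g_1,\ldots,g_n):k\ge 0,\ g_i\in G^+\}$ and Garside element $\delta(\Delta,\ldots,\Delta)$; ultra summit sets in $G(n)$ are taken with respect to these. Theorem. Let $G$ be a Garside group with positive monoid $G^+$ and Garside element $\Delta$, let $n\ge 1$ be an integer and let $g\in G$. Then $g$ has an $n$-th root in $G$ (that is, $x^n=g$ for some $x\in G$) if and only if the ultra summit set of $\delta(g,1,\ldots,1)$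 in $G(n)$ contains an element of the form $\delta(h,\ldots,h)$ with $h\in G$. Moreover, whenever $\delta(g,1,\ldots,1)=\gamma^{-1}\,\delta(h,\ldots,h)\,\gamma$ with $h\in G$ and $\gamma=\delta^k(x_1,\ldots,x_n)\in G(n)$, one has $g=(x_n^{-1}hx_n)^n$. -/

import Mathlib

namespace Garside

section MonoidSide

variable {M : Type*} [Monoid M]

/-- An atom (indivisible element): `a ≠ 1`, and `a = b c` only if `b = 1` or `c = 1`. -/
def IsMonoidAtom (a : M) : Prop :=
  a ≠ 1 ∧ ∀ b c : M, a = b * c → b = 1 ∨ c = 1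

/-- `M` is atomic: it is generated by its atoms, and for every `a` the lengths of the
expressions of `a` as a product of atoms are bounded. -/
def IsAtomicMonoid (M : Type*) [Monoid M] : Prop :=
  Submonoid.closure {a : M | IsMonoidAtom a} = ⊤ ∧
    ∀ a : M, ∃ N : ℕ, ∀ l : List M, (∀ s ∈ l, IsMonoidAtom s) → l.prod = a → l.length ≤ N

/-- `a ≤_L b` in the monoid `M`. -/
def MonLeL (a b : M) : Prop := ∃ c : M, a * c = b

/-- `a ≤_R b` in the monoid `M`. -/
def MonLeR (a b : M) : Prop := ∃ c : M, c * a = b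

/-- The relation `r` is a partial order in which any two elements have a greatest lower bound
and a least upper bound, that is, `(α, r)` is a lattice. -/
structure IsLatticeRel {α : Type*} (r : α → α → Prop) : Prop where
  refl : ∀ a, r a a
  trans : ∀ a b c, r a b → r b c → r a c
  antisymm : ∀ a b, r a b → r b a → a = b
  exists_inf : ∀ a b, ∃ m, r m a ∧ r m b ∧ ∀ c, r c a → r c b → r c m
  exists_sup : ∀ a b, ∃ m, r a m ∧ r b m ∧ ∀ c, r a c → r b c → r m c

/-- `Δ` is a Garside element: its left divisors `L(Δ)` and right divisors `R(Δ)` are the same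
set, and this set generates `M`. -/
def IsGarsideElement (Δ : M) : Prop :=
  {b : M | MonLeL b Δ} = {b : M | MonLeR b Δ} ∧
    Submonoid.closure {b : M | MonLeL b Δ} = ⊤

/-- Garside monoids. -/
structure IsGarsideMonoid (M : Type*) [Monoid M] : Prop where
  atomic : IsAtomicMonoid M
  fg : Monoid.FG M
  cancel : IsCancelMul M
  lattice_left : IsLatticeRel (MonLeL (M := M))
  lattice_right : IsLatticeRel (MonLeR (M := M))
  exists_garside : ∃ Δ : M, IsGarsideElement Δ

end MonoidSide

section GroupSide

variable {G : Type*} [Group G]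

/-- The group `G` is the group of fractions of its submonoid `P`. -/
def IsGroupOfFractions (P : Submonoid G) : Prop :=
  ∀ g : G, ∃ a ∈ P, ∃ b ∈ P, g = a * b⁻¹

/-- `g ≤_L h` in the group `G` with positive monoid `P`. -/
def LeL (P : Submonoid G) (g h : G) : Prop := ∃ c ∈ P, g * c = h

/-- `inf(g) = max {r : Δ^r ≤_L g}`. -/
noncomputable def inf (P : Submonoid G) (Δ g : G) : ℤ :=
  sSup {r : ℤ | LeL P (Δ ^ r) g}

/-- `sup(g) = min {s : g ≤_L Δ^s}`. -/
noncomputable def sup (P : Submonoid G) (Δ g : G) : ℤ :=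
  sInf {s : ℤ | LeL P g (Δ ^ s)}

/-- `inf_s(g) = max {inf(h) : h conjugate to g}`. -/
noncomputable def infS (P : Submonoid G) (Δ g : G) : ℤ :=
  sSup {r : ℤ | ∃ h : G, IsConj g h ∧ r = inf P Δ h}

/-- `sup_s(g) = min {sup(h) : h conjugate to g}`. -/
noncomputable def supS (P : Submonoid G) (Δ g : G) : ℤ :=
  sInf {s : ℤ | ∃ h : G, IsConj g h ∧ s = sup P Δ h}

/-- The super summit set of `g`. -/
def superSummitSet (P : Submonoid G) (Δ g : G) : Set G :=
  {h | IsConj g h ∧ inf P Δ h = infS P Δ g ∧ sup P Δ h = supS P Δ g}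

/-- The automorphism `τ(g) = Δ⁻¹ g Δ`. -/
def tau (Δ : G) : MulAut G := MulAut.conj Δ⁻¹

/-- `d = a ∧_L b`: the positive element `d` is the greatest common divisor of `a` and `b` with
respect to `≤_L` among the positive elements. -/
def IsGcdL (P : Submonoid G) (a b d : G) : Prop :=
  d ∈ P ∧ LeL P d a ∧ LeL P d b ∧ ∀ c ∈ P, LeL P c a → LeL P c b → LeL P c d

/-- `Δ^r s₁ ⋯ s_k` is the normal form of `g`, where `l = [s₁, …, s_k]`: each `s_i` is a simple
element other than `1` and `Δ`, and `(s_i s_{i+1} ⋯ s_k) ∧_L Δ = s_i`. -/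
def IsNormalForm (P : Submonoid G) (Δ g : G) (r : ℤ) (l : List G) : Prop :=
  g = Δ ^ r * l.prod ∧
    (∀ s ∈ l, s ∈ P ∧ LeL P s Δ ∧ s ≠ 1 ∧ s ≠ Δ) ∧
    ∀ (i : ℕ) (hi : i < l.length), IsGcdL P (l.drop i).prod Δ l[i]

open Classical in
/-- The exponent and the simple factors of the normal form of `g` (which exists and is unique
in a Garside group whose Garside element is not `1`). -/
noncomputable def normalForm (P : Submonoid G) (Δ g : G) : ℤ × List G :=
  if H : ∃ p : ℤ × List G, IsNormalForm P Δ g p.1 p.2 then H.choose else (0, [])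

/-- `Δ^r s₂ ⋯ s_k τ^{-r}(s₁)`, and `Δ^r` if there are no factors `s_i`. -/
def cycleList (Δ : G) (r : ℤ) : List G → G
  | [] => Δ ^ r
  | s :: t => Δ ^ r * t.prod * (tau Δ ^ (-r)) s

/-- The cycling `c(g)`: if `Δ^r s₁ ⋯ s_k` is the normal form of `g`, then
`c(g) = Δ^r s₂ ⋯ s_k τ^{-r}(s₁)`; an element `g = Δ^r` is its own cycling. -/
noncomputable def cycling (P : Submonoid G) (Δ g : G) : G :=
  cycleList Δ (normalForm P Δ g).1 (normalForm P Δ g).2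

/-- The ultra summit set of `g`: the `h` in the super summit set of `g` with `c^k(h) = h` for
some `k > 0`. -/
def ultraSummitSet (P : Submonoid G) (Δ g : G) : Set G :=
  {h | h ∈ superSummitSet P Δ g ∧ ∃ k : ℕ, 0 < k ∧ (cycling P Δ)^[k] h = h}

end GroupSide

/-- The group `G(n) = ℤ ⋉ Gⁿ`, where `ℤ = ⟨δ⟩`; the element `⟨k, ![x₁, …, x_n]⟩` is
`δ^k (x₁, …, x_n)`. The coordinate `x_i` has the index `i - 1` in `Fin n`. -/
@[ext]
structure CyclicPower (n : ℕ) (G : Type*) where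
  exp : ℤ
  coord : Fin n → G

namespace CyclicPower

variable {n : ℕ} {G : Type*} [Group G]

/-- The right action `x ↦ x^{δ^m}` of `δ^m` on `Gⁿ`, with
`(x₁, …, x_n)^δ = (x_n, x₁, …, x_{n-1})`. -/
def rot (m : ℤ) (x : Fin n → G) : Fin n → G :=
  fun i => x ((finRotate n ^ (-m)) i)

/-- The product `δ^k x · δ^m y = δ^{k+m} (x^{δ^m} y)`. -/
instance : Mul (CyclicPower n G) :=
  ⟨fun a b => ⟨a.exp + b.exp, rot b.exp a.coord * b.coord⟩⟩

instance : One (CyclicPower n G) := ⟨⟨0, 1⟩⟩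

instance : Inv (CyclicPower n G) := ⟨fun a => ⟨-a.exp, rot (-a.exp) (a.coord)⁻¹⟩⟩

theorem mul_def (a b : CyclicPower n G) :
    a * b = ⟨a.exp + b.exp, rot b.exp a.coord * b.coord⟩ := rfl

theorem one_def : (1 : CyclicPower n G) = ⟨0, 1⟩ := rfl

theorem inv_def (a : CyclicPower n G) : a⁻¹ = ⟨-a.exp, rot (-a.exp) (a.coord)⁻¹⟩ := rfl

instance : Group (CyclicPower n G) :=
  Group.ofLeftAxioms
    (by
      intro a b c
      simp only [mul_def]
      ext i
      · simp [add_assoc]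
      · simp only [rot, Pi.mul_apply, mul_assoc]
        rw [← Equiv.Perm.mul_apply, ← zpow_add, neg_add])
    (by
      intro a
      simp only [mul_def, one_def]
      ext i <;> simp [rot])
    (by
      intro a
      simp only [mul_def, one_def, inv_def]
      ext i
      · simp
      · simp only [rot, Pi.mul_apply, Pi.inv_apply, Pi.one_apply]
        rw [← Equiv.Perm.mul_apply, ← zpow_add]
        simp)

/-- The positive monoid `G(n)⁺ = ℕ ⋉ (G⁺)ⁿ` of `G(n)`, where `P = G⁺`. -/
def positive (P : Submonoid G) (n : ℕ) : Submonoid (CyclicPower n G) where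
  carrier := {a | 0 ≤ a.exp ∧ ∀ i, a.coord i ∈ P}
  one_mem' := ⟨le_refl _, fun _ => P.one_mem⟩
  mul_mem' := fun {_ b} ha hb =>
    ⟨add_nonneg ha.1 hb.1, fun i => P.mul_mem (ha.2 ((finRotate n ^ (-b.exp)) i)) (hb.2 i)⟩

/-- The element `δ (h, …, h)` of `G(n)`. -/
def deltaConst (n : ℕ) (h : G) : CyclicPower n G := ⟨1, fun _ => h⟩

/-- The element `δ (g, 1, …, 1)` of `G(n)`. -/
def deltaFirst (n : ℕ) (g : G) : CyclicPower n G :=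
  ⟨1, fun i => if (i : ℕ) = 0 then g else 1⟩

end CyclicPower

end Garside

/-! Comparing coordinates in `γ δ(g,1,…,1) = δ(h,…,h) γ` with `γ = δ^k(x₁,…,x_n)` gives `x_i = h
x_{i+1}` for `i < n` and `x_n g = h x₁`. Hence `x₁ = h^{n-1} x_n` and `x_n g = h^n x_n`. This is the
last claim (`eq_conj_pow_of_deltaFirst_eq`), and it turns any conjugate `δ(h,…,h)` into a root.

Conversely, if `g = x^n`, the same equations solve to a conjugator from `δ(g,1,…,1)` to `δ(x,…,x)`.
What remains is to move `δ(x,…,x)` into the ultra summit set while keeping it invariant under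
conjugation by `δ`, an automorphism `σ` that preserves the positive monoid and the Garside element.
The positive elements conjugating it into the super summit set are closed under meets, so there is a
least one; `σ` permutes them and therefore fixes it (`exists_symmetric_mem_superSummitSet`). Cycling
is conjugation by a meet of two elements which `σ` fixes along with the element being cycled, so it
stays among the fixed elements of the finite super summit set, and some iterate is periodic. An
element of exponent 1 fixed by `σ` has equal coordinates.

The summit set theory uses only the order properties in `IsGarsideGroup`, which pass from `G⁺` to
`G` and then coordinatewise to `G(n)`. -/

namespace Garside

/-! ### The order of a Garside group and powers of its Garside element -/

section Axioms

variable {H : Type*} [Group H]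

/-- The properties of a Garside group `H` with positive monoid `Q` and Garside element `D` on
which the theory of summit sets rests. -/
structure IsGarsideGroup (Q : Submonoid H) (D : H) : Prop where
  eq_one_of_mem : ∀ a ∈ Q, a⁻¹ ∈ Q → a = 1
  garside_mem : D ∈ Q
  conj_mem : ∀ a ∈ Q, D⁻¹ * a * D ∈ Q
  conj_inv_mem : ∀ a ∈ Q, D * a * D⁻¹ ∈ Q
  exists_inf : ∀ a b : H, ∃ m, LeL Q m a ∧ LeL Q m b ∧ ∀ c, LeL Q c a → LeL Q c b → LeL Q c m
  exists_sup : ∀ a b : H, ∃ m, LeL Q a m ∧ LeL Q b m ∧ ∀ c, LeL Q a c → LeL Q b c → LeL Q m c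
  exists_le_pow : ∀ a : H, ∃ k : ℕ, LeL Q a (D ^ k)
  finite_le_pow : ∀ k : ℕ, {a : H | a ∈ Q ∧ LeL Q a (D ^ k)}.Finite

variable {Q : Submonoid H} {D : H}

theorem leL_iff {a b : H} : LeL Q a b ↔ a⁻¹ * b ∈ Q := by
  constructor
  · rintro ⟨c, hc, rfl⟩
    simpa using hc
  · intro h
    exact ⟨_, h, by simp⟩

theorem leL_refl (a : H) : LeL Q a a := leL_iff.2 (by simp [Q.one_mem])

theorem LeL.trans {a b c : H} (h₁ : LeL Q a b) (h₂ : LeL Q b c) : LeL Q a c := by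
  rw [leL_iff] at *
  simpa [mul_assoc] using Q.mul_mem h₁ h₂

theorem leL_mul_left_iff (c : H) {a b : H} : LeL Q (c * a) (c * b) ↔ LeL Q a b := by
  rw [leL_iff, leL_iff]
  simp [mul_assoc]

theorem one_leL_iff {a : H} : LeL Q 1 a ↔ a ∈ Q := by
  simp [leL_iff]

theorem leL_mul_right {a c : H} (hc : c ∈ Q) : LeL Q a (a * c) := ⟨c, hc, rfl⟩

theorem LeL.mem {a b : H} (h : LeL Q a b) (ha : a ∈ Q) : b ∈ Q := by
  obtain ⟨c, hc, rfl⟩ := h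
  exact Q.mul_mem ha hc

/-- Conjugation by `a` turns `X` into an element above `Y` exactly if `a Y ≤_L X a`. -/
theorem leL_conj_iff {a X Y : H} : LeL Q Y (a⁻¹ * X * a) ↔ LeL Q (a * Y) (X * a) := by
  rw [leL_iff, leL_iff]
  simp [mul_assoc]

theorem conj_leL_iff {a X Y : H} : LeL Q (a⁻¹ * X * a) Y ↔ LeL Q (X * a) (a * Y) := by
  rw [leL_iff, leL_iff]
  simp [mul_assoc]

namespace IsGarsideGroup

theorem antisymm (ax : IsGarsideGroup Q D) {a b : H} (h₁ : LeL Q a b) (h₂ : LeL Q b a) :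
    a = b := by
  rw [leL_iff] at *
  have := ax.eq_one_of_mem _ h₁ (by simpa using h₂)
  exact (inv_mul_eq_one.1 this)

theorem conj_zpow_mem (ax : IsGarsideGroup Q D) (r : ℤ) {a : H} (ha : a ∈ Q) :
    D ^ (-r) * a * D ^ r ∈ Q := by
  have h : ∀ k : ℕ, (D ^ k)⁻¹ * a * D ^ k ∈ Q ∧ D ^ k * a * (D ^ k)⁻¹ ∈ Q := by
    intro k
    induction k with
    | zero => simpa using ha
    | succ k ih =>
      refine ⟨?_, ?_⟩
      · have := ax.conj_mem _ ih.1
        simpa [pow_succ, mul_assoc] using this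
      · have := ax.conj_inv_mem _ ih.2
        simpa [pow_succ', mul_assoc] using this
  obtain ⟨k, rfl | rfl⟩ := r.eq_nat_or_neg
  · simpa using (h k).1
  · simpa using (h k).2

/-- `≤_L` is invariant under left multiplication only; powers of `D` may act on the right because
conjugation by `D` preserves `Q`. -/
theorem mul_zpow_leL_iff (ax : IsGarsideGroup Q D) (r : ℤ) {a b : H} :
    LeL Q (a * D ^ r) (b * D ^ r) ↔ LeL Q a b := by
  rw [leL_iff, leL_iff]
  constructor
  · intro h
    have := ax.conj_zpow_mem (-r) h
    simpa [mul_assoc] using this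
  · intro h
    have := ax.conj_zpow_mem r h
    simpa [mul_assoc] using this

theorem leL_mul_zpow_iff (ax : IsGarsideGroup Q D) (r : ℤ) {a b : H} :
    LeL Q a (b * D ^ r) ↔ LeL Q (a * D ^ (-r)) b := by
  rw [← ax.mul_zpow_leL_iff r (a := a * D ^ (-r))]
  simp

theorem zpow_mem (ax : IsGarsideGroup Q D) {r : ℤ} (hr : 0 ≤ r) : D ^ r ∈ Q := by
  lift r to ℕ using hr
  simpa using Q.pow_mem ax.garside_mem r

theorem zpow_leL_zpow (ax : IsGarsideGroup Q D) {r s : ℤ} (h : r ≤ s) :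
    LeL Q (D ^ r) (D ^ s) := by
  rw [leL_iff, ← zpow_neg, ← zpow_add]
  exact ax.zpow_mem (by omega)

theorem zpow_leL_zpow_iff (ax : IsGarsideGroup Q D) (hD : D ≠ 1) {r s : ℤ} :
    LeL Q (D ^ r) (D ^ s) ↔ r ≤ s := by
  refine ⟨fun h => ?_, ax.zpow_leL_zpow⟩
  by_contra! hlt
  apply hD
  refine ax.eq_one_of_mem _ ax.garside_mem ?_
  have h1 : LeL Q (D ^ (s + 1)) (D ^ s) := (ax.zpow_leL_zpow (by omega)).trans h
  rw [leL_iff, ← zpow_neg, ← zpow_add] at h1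
  simpa using h1

theorem zpow_leL_mul_zpow (ax : IsGarsideGroup Q D) (r : ℤ) {a : H} (ha : a ∈ Q) :
    LeL Q (D ^ r) (a * D ^ r) := by
  have := (ax.mul_zpow_leL_iff r (a := 1) (b := a)).2 (one_leL_iff.2 ha)
  simpa using this

theorem exists_pow_mul_mem (ax : IsGarsideGroup Q D) (a : H) : ∃ k : ℕ, a * D ^ k ∈ Q := by
  obtain ⟨k, hk⟩ := ax.exists_le_pow a⁻¹
  refine ⟨k, ?_⟩
  simpa [leL_iff] using hk

theorem exists_zpow_leL (ax : IsGarsideGroup Q D) (a : H) : ∃ r : ℤ, LeL Q (D ^ r) a := by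
  obtain ⟨k, hk⟩ := ax.exists_pow_mul_mem a
  refine ⟨-k, ?_⟩
  rw [← one_leL_iff, ← zpow_natCast, ax.leL_mul_zpow_iff] at hk
  simpa using hk

theorem exists_leL_zpow (ax : IsGarsideGroup Q D) (a : H) : ∃ r : ℤ, LeL Q a (D ^ r) := by
  obtain ⟨k, hk⟩ := ax.exists_le_pow a
  exact ⟨k, by simpa using hk⟩

theorem finite_interval (ax : IsGarsideGroup Q D) (a b : H) :
    {c : H | LeL Q a c ∧ LeL Q c b}.Finite := by
  obtain ⟨k, hk⟩ := ax.exists_le_pow (a⁻¹ * b)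
  refine ((ax.finite_le_pow k).image (a * ·)).subset ?_
  rintro c ⟨h1, h2⟩
  refine ⟨a⁻¹ * c, ⟨leL_iff.1 h1, LeL.trans ?_ hk⟩, by simp⟩
  exact (leL_mul_left_iff a⁻¹).2 h2

theorem finite_divisors (ax : IsGarsideGroup Q D) (b : H) :
    {c : H | c ∈ Q ∧ LeL Q c b}.Finite := by
  simpa only [one_leL_iff] using ax.finite_interval 1 b

theorem ncard_divisors_lt (ax : IsGarsideGroup Q D) {a b : H} (hb : b ∈ Q) (hab : LeL Q a b)
    (hne : a ≠ b) : {c : H | c ∈ Q ∧ LeL Q c a}.ncard < {c : H | c ∈ Q ∧ LeL Q c b}.ncard := by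
  refine Set.ncard_lt_ncard ?_ (ax.finite_divisors b)
  have hsub : {c : H | c ∈ Q ∧ LeL Q c a} ⊆ {c : H | c ∈ Q ∧ LeL Q c b} :=
    fun c hc => ⟨hc.1, hc.2.trans hab⟩
  rw [Set.ssubset_iff_of_subset hsub]
  exact ⟨b, ⟨hb, leL_refl b⟩, fun h => hne (ax.antisymm hab h.2)⟩

/-- A nonempty set of positive elements that is closed under meets has a least element. -/
theorem exists_least (ax : IsGarsideGroup Q D) {S : Set H} (hS : S.Nonempty)
    (hpos : ∀ a ∈ S, a ∈ Q)
    (hmeet : ∀ a ∈ S, ∀ b ∈ S, ∀ m, LeL Q m a → LeL Q m b →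
      (∀ c, LeL Q c a → LeL Q c b → LeL Q c m) → m ∈ S) :
    ∃ a ∈ S, ∀ b ∈ S, LeL Q a b := by
  -- The number of positive divisors drops strictly below a positive element, so it serves as a
  -- rank.
  obtain ⟨a, ha, hmin⟩ := exists_minimalFor_of_wellFoundedLT (· ∈ S)
    (fun a => {c : H | c ∈ Q ∧ LeL Q c a}.ncard) hS
  refine ⟨a, ha, fun b hb => ?_⟩
  obtain ⟨m, hma, hmb, hm⟩ := ax.exists_inf a b
  have hmS := hmeet a ha b hb m hma hmb hm
  by_cases hne : m = a
  · exact hne ▸ hmb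
  · have h1 := ax.ncard_divisors_lt (hpos a ha) hma hne
    exact absurd (hmin hmS h1.le) (not_le.2 h1)

/-! ### Infimum and supremum -/

theorem le_inf_iff (ax : IsGarsideGroup Q D) (hD : D ≠ 1) {r : ℤ} {g : H} :
    r ≤ inf Q D g ↔ LeL Q (D ^ r) g := by
  obtain ⟨s, hs⟩ := ax.exists_leL_zpow g
  have hb : BddAbove {r : ℤ | LeL Q (D ^ r) g} :=
    ⟨s, fun r hr => (ax.zpow_leL_zpow_iff hD).1 (hr.trans hs)⟩
  have hne : {r : ℤ | LeL Q (D ^ r) g}.Nonempty := ax.exists_zpow_leL g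
  exact ⟨fun h => (ax.zpow_leL_zpow h).trans (Int.csSup_mem hne hb), fun h => le_csSup hb h⟩

theorem sup_le_iff (ax : IsGarsideGroup Q D) (hD : D ≠ 1) {s : ℤ} {g : H} :
    sup Q D g ≤ s ↔ LeL Q g (D ^ s) := by
  obtain ⟨r, hr⟩ := ax.exists_zpow_leL g
  have hb : BddBelow {s : ℤ | LeL Q g (D ^ s)} :=
    ⟨r, fun s hs => (ax.zpow_leL_zpow_iff hD).1 (hr.trans hs)⟩
  have hne : {s : ℤ | LeL Q g (D ^ s)}.Nonempty := ax.exists_leL_zpow g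
  exact ⟨fun h => LeL.trans (Int.csInf_mem hne hb) (ax.zpow_leL_zpow h), fun h => csInf_le hb h⟩

theorem zpow_leL_pow (ax : IsGarsideGroup Q D) {r : ℤ} {g : H} (h : LeL Q (D ^ r) g) (k : ℕ) :
    LeL Q (D ^ (r * k)) (g ^ k) := by
  induction k with
  | zero => simpa using leL_refl (1 : H)
  | succ k ih =>
    have h1 := (ax.mul_zpow_leL_iff (r * k)).2 h
    rw [pow_succ', Nat.cast_succ, mul_add, mul_one, add_comm, zpow_add]
    exact h1.trans ((leL_mul_left_iff g).2 ih)

theorem pow_leL_zpow (ax : IsGarsideGroup Q D) {s : ℤ} {g : H} (h : LeL Q g (D ^ s)) (k : ℕ) :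
    LeL Q (g ^ k) (D ^ (s * k)) := by
  induction k with
  | zero => simpa using leL_refl (1 : H)
  | succ k ih =>
    have h1 := (ax.mul_zpow_leL_iff (s * k)).2 h
    rw [pow_succ', Nat.cast_succ, mul_add, mul_one, add_comm, zpow_add]
    exact ((leL_mul_left_iff g).2 ih).trans h1

/-- The `k`-th powers of the two conjugates lie above `D^{rk}` and below `D^{sk}`, and conjugating
costs a power of `D` independent of `k`; large `k` forces `r ≤ s`. This bounds the sets behind
`infS` and `supS`, so their extrema are attained. -/
theorem inf_le_sup_of_isConj (ax : IsGarsideGroup Q D) (hD : D ≠ 1) {g h : H}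
    (hgh : IsConj g h) : inf Q D h ≤ sup Q D g := by
  obtain ⟨a, rfl⟩ := isConj_iff.1 hgh
  obtain ⟨u, hu⟩ := ax.exists_leL_zpow a
  obtain ⟨v, hv⟩ := ax.exists_leL_zpow a⁻¹
  set r := inf Q D (a * g * a⁻¹)
  set s := sup Q D g
  have key : ∀ k : ℕ, r * k ≤ u + s * k + v := by
    intro k
    have h1 := ax.zpow_leL_pow ((ax.le_inf_iff hD).1 (le_refl r)) k
    have h2 := ax.pow_leL_zpow ((ax.sup_le_iff hD).1 (le_refl s)) k
    have h3 : LeL Q ((a * g * a⁻¹) ^ k) (D ^ (u + s * k + v)) := by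
      rw [conj_pow, mul_assoc, show u + s * k + v = u + (s * k + v) by ring, zpow_add]
      have h4 : LeL Q (g ^ k * a⁻¹) (D ^ (s * k + v)) := by
        rw [add_comm, zpow_add]
        refine ((leL_mul_left_iff _).2 hv).trans ?_
        rw [← zpow_add, add_comm, zpow_add]
        exact (ax.mul_zpow_leL_iff v).2 h2
      exact ((leL_mul_left_iff a).2 h4).trans ((ax.mul_zpow_leL_iff _).2 hu)
    exact (ax.zpow_leL_zpow_iff hD).1 (h1.trans h3)
  by_contra! hlt
  -- If `r ≥ s + 1`, then `key` gives `k ≤ u + v`, which fails for `k = |u + v| + 1`.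
  have h5 := key (u + v).natAbs.succ
  have h6 : u + v ≤ (u + v).natAbs := by omega
  push_cast [Nat.succ_eq_add_one] at h5 h6
  nlinarith [mul_nonneg (sub_nonneg.2 (Int.add_one_le_iff.2 hlt)) (abs_nonneg (u + v))]

theorem infS_spec (ax : IsGarsideGroup Q D) (hD : D ≠ 1) (g : H) :
    (∃ h, IsConj g h ∧ inf Q D h = infS Q D g) ∧ ∀ h, IsConj g h → inf Q D h ≤ infS Q D g := by
  have hb : BddAbove {r : ℤ | ∃ h : H, IsConj g h ∧ r = inf Q D h} := by
    refine ⟨sup Q D g, ?_⟩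
    rintro _ ⟨h, hh, rfl⟩
    exact ax.inf_le_sup_of_isConj hD hh
  have hne : {r : ℤ | ∃ h : H, IsConj g h ∧ r = inf Q D h}.Nonempty :=
    ⟨_, g, IsConj.refl g, rfl⟩
  obtain ⟨h, h1, h2⟩ := Int.csSup_mem hne hb
  exact ⟨⟨h, h1, h2.symm⟩, fun h hh => le_csSup hb ⟨h, hh, rfl⟩⟩

theorem supS_spec (ax : IsGarsideGroup Q D) (hD : D ≠ 1) (g : H) :
    (∃ h, IsConj g h ∧ sup Q D h = supS Q D g) ∧ ∀ h, IsConj g h → supS Q D g ≤ sup Q D h := by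
  have hb : BddBelow {s : ℤ | ∃ h : H, IsConj g h ∧ s = sup Q D h} := by
    refine ⟨inf Q D g, ?_⟩
    rintro _ ⟨h, hh, rfl⟩
    exact ax.inf_le_sup_of_isConj hD hh.symm
  have hne : {s : ℤ | ∃ h : H, IsConj g h ∧ s = sup Q D h}.Nonempty :=
    ⟨_, g, IsConj.refl g, rfl⟩
  obtain ⟨h, h1, h2⟩ := Int.csInf_mem hne hb
  exact ⟨⟨h, h1, h2.symm⟩, fun h hh => csInf_le hb ⟨h, hh, rfl⟩⟩

theorem mem_superSummitSet_iff (ax : IsGarsideGroup Q D) (hD : D ≠ 1) {g h : H} :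
    h ∈ superSummitSet Q D g ↔
      IsConj g h ∧ LeL Q (D ^ infS Q D g) h ∧ LeL Q h (D ^ supS Q D g) := by
  rw [← ax.le_inf_iff hD, ← ax.sup_le_iff hD]
  constructor
  · rintro ⟨h1, h2, h3⟩
    exact ⟨h1, h2.ge, h3.le⟩
  · rintro ⟨h1, h2, h3⟩
    exact ⟨h1, le_antisymm ((ax.infS_spec hD g).2 h h1) h2,
      le_antisymm h3 ((ax.supS_spec hD g).2 h h1)⟩

theorem finite_superSummitSet (ax : IsGarsideGroup Q D) (hD : D ≠ 1) (g : H) :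
    (superSummitSet Q D g).Finite :=
  (ax.finite_interval (D ^ infS Q D g) (D ^ supS Q D g)).subset fun _ hh =>
    ((ax.mem_superSummitSet_iff hD).1 hh).2

/-! ### Convexity of the conditions on conjugating elements -/

/-- The bound says `X⁻¹ a D^r ≤_L a`. The map `a ↦ X⁻¹ a D^r` is monotone, and the elements that a
monotone map sends below themselves are closed under meets. The two lemmas that follow are variants.
-/
theorem zpow_leL_conj_meet (ax : IsGarsideGroup Q D) {X a b m : H} {r : ℤ}
    (ha : LeL Q (D ^ r) (a⁻¹ * X * a)) (hb : LeL Q (D ^ r) (b⁻¹ * X * b))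
    (hma : LeL Q m a) (hmb : LeL Q m b) (hm : ∀ c, LeL Q c a → LeL Q c b → LeL Q c m) :
    LeL Q (D ^ r) (m⁻¹ * X * m) := by
  rw [leL_conj_iff] at *
  rw [← leL_mul_left_iff X⁻¹, inv_mul_cancel_left]
  refine hm _ ?_ ?_
  · rw [← leL_mul_left_iff X, mul_inv_cancel_left]
    exact ((ax.mul_zpow_leL_iff r).2 hma).trans ha
  · rw [← leL_mul_left_iff X, mul_inv_cancel_left]
    exact ((ax.mul_zpow_leL_iff r).2 hmb).trans hb

theorem conj_meet_leL_zpow (ax : IsGarsideGroup Q D) {X a b m : H} {s : ℤ}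
    (ha : LeL Q (a⁻¹ * X * a) (D ^ s)) (hb : LeL Q (b⁻¹ * X * b) (D ^ s))
    (hma : LeL Q m a) (hmb : LeL Q m b) (hm : ∀ c, LeL Q c a → LeL Q c b → LeL Q c m) :
    LeL Q (m⁻¹ * X * m) (D ^ s) := by
  rw [conj_leL_iff, ax.leL_mul_zpow_iff] at *
  refine hm _ ?_ ?_
  · exact ((ax.mul_zpow_leL_iff _).2 ((leL_mul_left_iff X).2 hma)).trans ha
  · exact ((ax.mul_zpow_leL_iff _).2 ((leL_mul_left_iff X).2 hmb)).trans hb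

theorem conj_join_leL_zpow (ax : IsGarsideGroup Q D) {X a b m : H} {s : ℤ}
    (ha : LeL Q (a⁻¹ * X * a) (D ^ s)) (hb : LeL Q (b⁻¹ * X * b) (D ^ s))
    (ham : LeL Q a m) (hbm : LeL Q b m) (hm : ∀ c, LeL Q a c → LeL Q b c → LeL Q m c) :
    LeL Q (m⁻¹ * X * m) (D ^ s) := by
  rw [conj_leL_iff] at *
  rw [← leL_mul_left_iff X⁻¹, inv_mul_cancel_left]
  refine hm _ ?_ ?_
  · rw [← leL_mul_left_iff X, mul_inv_cancel_left]
    exact ha.trans ((ax.mul_zpow_leL_iff _).2 ham)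
  · rw [← leL_mul_left_iff X, mul_inv_cancel_left]
    exact hb.trans ((ax.mul_zpow_leL_iff _).2 hbm)

/-- A conjugate of `X` by a suitable positive element has a prescribed lower bound `D ^ r` as
soon as some conjugate has, and any upper bound `D ^ s` of `X` is kept. -/
theorem exists_conj_between (ax : IsGarsideGroup Q D) {X a : H} {r s : ℤ}
    (haQ : a ∈ Q) (hX : LeL Q X (D ^ s)) (ha : LeL Q (D ^ r) (a⁻¹ * X * a)) :
    ∃ b, LeL Q (D ^ r) (b⁻¹ * X * b) ∧ LeL Q (b⁻¹ * X * b) (D ^ s) := by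
  let T : Set H := {b | b ∈ Q ∧ LeL Q b a ∧ LeL Q (b⁻¹ * X * b) (D ^ s)}
  have hTfin : T.Finite := (ax.finite_divisors a).subset fun b hb => ⟨hb.1, hb.2.1⟩
  have hT1 : (1 : H) ∈ T := ⟨Q.one_mem, one_leL_iff.2 haQ, by simpa using hX⟩
  -- A maximal divisor `b` of `a` that keeps the upper bound already attains the lower one:
  -- otherwise it could be enlarged by a join.
  obtain ⟨b, hb, hmax⟩ := hTfin.exists_maximalFor
    (fun b => {c : H | c ∈ Q ∧ LeL Q c b}.ncard) T ⟨1, hT1⟩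
  refine ⟨b, ?_, hb.2.2⟩
  set Y := b⁻¹ * X * b with hY
  have hYa : LeL Q (b * Y⁻¹ * D ^ r) a := by
    rw [leL_conj_iff] at ha
    have h1 : LeL Q (b * D ^ r) (a * D ^ r) := (ax.mul_zpow_leL_iff r).2 hb.2.1
    have h2 := (leL_mul_left_iff X⁻¹).2 (h1.trans ha)
    simpa [hY, mul_assoc] using h2
  -- The second element conjugates `X` to `D^{-r} Y D^r`, still below `D^s`. So the join lies in `T`
  -- and equals `b`, whence `b Y⁻¹ D^r ≤_L b`, that is, `D^r ≤_L Y`.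
  obtain ⟨m, h1, h2, h3⟩ := ax.exists_sup b (b * Y⁻¹ * D ^ r)
  have hm : m ∈ T := by
    refine ⟨h1.mem hb.1, h3 a hb.2.1 hYa, ?_⟩
    refine ax.conj_join_leL_zpow hb.2.2 ?_ h1 h2 h3
    have h4 : LeL Q (D ^ (-r) * Y * D ^ r) (D ^ s) := by
      have h5 := (ax.mul_zpow_leL_iff r).2 ((leL_mul_left_iff (D ^ (-r))).2 hb.2.2)
      rwa [← zpow_add, ← zpow_add, show -r + s + r = s by ring] at h5
    have h6 : (b * Y⁻¹ * D ^ r)⁻¹ * X * (b * Y⁻¹ * D ^ r) = D ^ (-r) * Y * D ^ r := by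
      rw [hY]
      group
    rwa [h6]
  have hmb : m = b := by
    by_contra hne
    have h4 := ax.ncard_divisors_lt hm.1 h1 (Ne.symm hne)
    exact absurd (hmax hm h4.le) (not_le.2 h4)
  rw [hmb, mul_assoc] at h2
  rw [← leL_mul_left_iff (b * Y⁻¹)]
  simpa [mul_assoc] using h2

theorem conj_zpow_leL (ax : IsGarsideGroup Q D) {X : H} {r k : ℤ} :
    LeL Q (D ^ r) ((D ^ k)⁻¹ * X * D ^ k) ↔ LeL Q (D ^ r) X := by
  rw [leL_conj_iff, ← zpow_add, add_comm, zpow_add, ax.mul_zpow_leL_iff]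

theorem leL_conj_zpow (ax : IsGarsideGroup Q D) {X : H} {r k : ℤ} :
    LeL Q ((D ^ k)⁻¹ * X * D ^ k) (D ^ r) ↔ LeL Q X (D ^ r) := by
  rw [conj_leL_iff, ← zpow_add, add_comm, zpow_add, ax.mul_zpow_leL_iff]

/-- Conjugators may be taken positive without changing bounds by powers of `D`. -/
theorem exists_pos_conj (ax : IsGarsideGroup Q D) {X Y : H} (h : IsConj X Y) :
    ∃ a ∈ Q, (∀ r : ℤ, LeL Q (D ^ r) (a⁻¹ * X * a) ↔ LeL Q (D ^ r) Y) ∧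
      ∀ s : ℤ, LeL Q (a⁻¹ * X * a) (D ^ s) ↔ LeL Q Y (D ^ s) := by
  obtain ⟨c, rfl⟩ := isConj_iff.1 h
  obtain ⟨k, hk⟩ := ax.exists_pow_mul_mem c⁻¹
  have h1 : (c⁻¹ * D ^ k)⁻¹ * X * (c⁻¹ * D ^ k)
      = (D ^ (k : ℤ))⁻¹ * (c * X * c⁻¹) * D ^ (k : ℤ) := by
    rw [zpow_natCast]
    group
  refine ⟨_, hk, fun r => ?_, fun s => ?_⟩
  · rw [h1, ax.conj_zpow_leL]
  · rw [h1, ax.leL_conj_zpow]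

theorem isConj_conj (X a : H) : IsConj X (a⁻¹ * X * a) :=
  isConj_iff.2 ⟨a⁻¹, by simp⟩

/-- The two extrema could a priori be attained at different conjugates; from one with minimal `sup`,
`inf` is raised to its maximum without losing the upper bound. -/
theorem superSummitSet_nonempty (ax : IsGarsideGroup Q D) (hD : D ≠ 1) (g : H) :
    (superSummitSet Q D g).Nonempty := by
  obtain ⟨X, hgX, hX⟩ := (ax.supS_spec hD g).1
  obtain ⟨Y, hgY, hY⟩ := (ax.infS_spec hD g).1
  obtain ⟨a, haQ, ha, -⟩ := ax.exists_pos_conj (hgX.symm.trans hgY)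
  obtain ⟨b, h1, h2⟩ := ax.exists_conj_between haQ ((ax.sup_le_iff hD).1 hX.le)
    ((ha _).2 ((ax.le_inf_iff hD).1 hY.ge))
  exact ⟨_, (ax.mem_superSummitSet_iff hD).2 ⟨hgX.trans (isConj_conj X b), h1, h2⟩⟩

/-! ### Normal forms and cycling -/

/-- If the meet with `D` were `1`, descent on `k` would kill every positive `x` below `p` and
`D^{k+1}`: `x D^{-k}` is below both `p` and `D`, hence below `1`, so `x ≤_L D^k`. Here `x D^{-k}`
need not be positive, so `hm` ranges over the group. -/
theorem exists_simple_meet_ne_one (ax : IsGarsideGroup Q D) {p : H} (hp : p ∈ Q) (hne : p ≠ 1)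
    {m : H} (hm : ∀ c, LeL Q c p → LeL Q c D → LeL Q c m) : m ≠ 1 := by
  rintro rfl
  apply hne
  have key : ∀ (k : ℕ) (x : H), x ∈ Q → LeL Q x p → LeL Q x (D ^ k) → x = 1 := by
    intro k
    induction k with
    | zero =>
      intro x hx _ h
      exact ax.antisymm (by simpa using h) (one_leL_iff.2 hx)
    | succ k ih =>
      intro x hx hxp hxD
      refine ih x hx hxp ?_
      have h1 : LeL Q (x * D ^ (-(k : ℤ))) 1 := by
        refine hm _ ?_ ?_
        · rw [← ax.leL_mul_zpow_iff]
          refine hxp.trans (leL_mul_right (ax.zpow_mem (by omega)))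
        · rw [← ax.leL_mul_zpow_iff, zpow_natCast, ← pow_succ']
          exact hxD
      rw [← ax.leL_mul_zpow_iff] at h1
      simpa using h1
  obtain ⟨k, hk⟩ := ax.exists_le_pow p
  exact key k p hp (leL_refl p) hk

theorem exists_simple_factors (ax : IsGarsideGroup Q D) (N : ℕ) (p : H) (hp : p ∈ Q)
    (hDp : ¬ LeL Q D p) (hN : {c : H | c ∈ Q ∧ LeL Q c p}.ncard ≤ N) :
    ∃ l : List H, p = l.prod ∧ (∀ s ∈ l, s ∈ Q ∧ LeL Q s D ∧ s ≠ 1 ∧ s ≠ D) ∧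
      ∀ (i : ℕ) (hi : i < l.length), IsGcdL Q (l.drop i).prod D l[i] := by
  induction N generalizing p with
  | zero =>
    have h1 : {c : H | c ∈ Q ∧ LeL Q c p} = ∅ :=
      (Set.ncard_eq_zero (ax.finite_divisors p)).1 (by omega)
    exact absurd (show p ∈ {c : H | c ∈ Q ∧ LeL Q c p} from ⟨hp, leL_refl p⟩) (by simp [h1])
  | succ N ih =>
    by_cases hp1 : p = 1
    · exact ⟨[], by simpa using hp1, by simp, by simp⟩
    obtain ⟨m, hmp, hmD, hm⟩ := ax.exists_inf p D
    have hm1 := ax.exists_simple_meet_ne_one hp hp1 hm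
    have hmQ : m ∈ Q := one_leL_iff.1 (hm 1 (one_leL_iff.2 hp) (one_leL_iff.2 ax.garside_mem))
    obtain ⟨q, hq, rfl⟩ := hmp
    have hDq : ¬ LeL Q D q := by
      intro h
      apply hDp
      have h1 : LeL Q D (m * D) := by simpa using ax.zpow_leL_mul_zpow 1 hmQ
      exact h1.trans ((leL_mul_left_iff m).2 h)
    -- Left multiplication by `m` embeds the divisors of `q` into those of `m q` and misses `1`.
    have hcard : {c : H | c ∈ Q ∧ LeL Q c q}.ncard ≤ N := by
      have h1 : ((m * ·) '' {c : H | c ∈ Q ∧ LeL Q c q}).ncard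
          < {c : H | c ∈ Q ∧ LeL Q c (m * q)}.ncard := by
        refine Set.ncard_lt_ncard ?_ (ax.finite_divisors _)
        rw [Set.ssubset_iff_of_subset]
        · refine ⟨1, ⟨Q.one_mem, one_leL_iff.2 hp⟩, ?_⟩
          rintro ⟨c, hc, h⟩
          refine hm1 (ax.eq_one_of_mem m hmQ ?_)
          rw [inv_eq_of_mul_eq_one_right h]
          exact hc.1
        · rintro _ ⟨c, hc, rfl⟩
          exact ⟨Q.mul_mem hmQ hc.1, (leL_mul_left_iff m).2 hc.2⟩
      rw [Set.ncard_image_of_injective _ (mul_right_injective m)] at h1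
      omega
    obtain ⟨l, hl, hs, hg⟩ := ih q hq hDq hcard
    refine ⟨m :: l, by rw [List.prod_cons, hl], ?_, ?_⟩
    · intro s hsl
      rcases List.mem_cons.1 hsl with rfl | h
      · refine ⟨hmQ, hmD, hm1, ?_⟩
        rintro rfl
        exact hDp (leL_mul_right hq)
      · exact hs s h
    · intro i hi
      cases i with
      | zero =>
        refine ⟨hmQ, ?_, hmD, fun c _ h1 h2 => hm c ?_ h2⟩
        · simpa [← hl] using leL_mul_right hq
        · simpa [← hl] using h1
      | succ i => simpa using hg i (by simpa using hi)

theorem exists_normalForm (ax : IsGarsideGroup Q D) (hD : D ≠ 1) (g : H) :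
    ∃ p : ℤ × List H, IsNormalForm Q D g p.1 p.2 := by
  obtain ⟨q, hq, hg⟩ := (ax.le_inf_iff hD).1 (le_refl (inf Q D g))
  have hDq : ¬ LeL Q D q := by
    intro h
    have h1 := (leL_mul_left_iff (D ^ inf Q D g)).2 h
    rw [hg, ← zpow_add_one, ← ax.le_inf_iff hD] at h1
    omega
  obtain ⟨l, h1, h2, h3⟩ := ax.exists_simple_factors _ q hq hDq le_rfl
  exact ⟨(inf Q D g, l), by rw [← h1, hg], h2, h3⟩

/-- If `D` divided `s₁⋯s_k`, it would divide the gcd `s₁`, forcing `s₁ = D`. This pins down the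
exponent of a normal form obtained by choice. -/
theorem exponent_eq_inf (ax : IsGarsideGroup Q D) (hD : D ≠ 1) {g : H} {r : ℤ} {l : List H}
    (h : IsNormalForm Q D g r l) : r = inf Q D g := by
  obtain ⟨rfl, hs, hg⟩ := h
  have hl : l.prod ∈ Q := Q.list_prod_mem fun s h => (hs s h).1
  refine le_antisymm ((ax.le_inf_iff hD).2 (leL_mul_right hl)) ?_
  by_contra! hlt
  have h1 : LeL Q (D ^ (r + 1)) (D ^ r * l.prod) := (ax.le_inf_iff hD).1 hlt
  rw [zpow_add_one, leL_mul_left_iff] at h1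
  cases l with
  | nil =>
    exact hD (ax.antisymm (by simpa using h1) (one_leL_iff.2 ax.garside_mem))
  | cons s t =>
    have h2 := hg 0 (by simp)
    have h3 := hs s (by simp)
    exact h3.2.2.2 (ax.antisymm h3.2.1 (h2.2.2.2 D ax.garside_mem h1 (leL_refl D)))

/-- The cycling of `g` is the conjugate of `g` by `g D^{-inf(g)} ∧_L D`. -/
theorem cycling_eq_conj (ax : IsGarsideGroup Q D) (hD : D ≠ 1) {g m : H}
    (hmg : LeL Q m (g * D ^ (-inf Q D g))) (hmD : LeL Q m D)
    (hm : ∀ c, LeL Q c (g * D ^ (-inf Q D g)) → LeL Q c D → LeL Q c m) :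
    cycling Q D g = m⁻¹ * g * m := by
  have hex := ax.exists_normalForm hD g
  have hnf : IsNormalForm Q D g (normalForm Q D g).1 (normalForm Q D g).2 := by
    unfold normalForm
    rw [dif_pos hex]
    exact hex.choose_spec
  unfold cycling
  generalize (normalForm Q D g).1 = r at *
  generalize (normalForm Q D g).2 = l at *
  have hr := ax.exponent_eq_inf hD hnf
  rw [← hr] at hmg hm
  obtain ⟨hg, hs, hgcd⟩ := hnf
  cases l with
  | nil =>
    have hg' : g = D ^ r := by simpa using hg
    have hm1 : m = 1 := by
      refine ax.antisymm (by simpa [hg'] using hmg) (hm 1 ?_ (one_leL_iff.2 ax.garside_mem))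
      simpa [hg'] using leL_refl (1 : H)
    simp [cycleList, hm1, hg']
  | cons s t =>
    have h1 : IsGcdL Q (s * t.prod) D s := by
      have := hgcd 0 (by simp)
      simp only [List.drop_zero, List.prod_cons, List.getElem_cons_zero] at this
      exact this
    have htr : ∀ {a b : H}, LeL Q a b → LeL Q (D ^ r * a * D ^ (-r)) (D ^ r * b * D ^ (-r)) :=
      fun h => (ax.mul_zpow_leL_iff (-r)).2 ((leL_mul_left_iff _).2 h)
    have htr' : ∀ {a b : H}, LeL Q a b → LeL Q (D ^ (-r) * a * D ^ r) (D ^ (-r) * b * D ^ r) :=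
      fun h => (ax.mul_zpow_leL_iff r).2 ((leL_mul_left_iff _).2 h)
    have hDr : D ^ r * D * D ^ (-r) = D := by group
    have hDr' : D ^ (-r) * D * D ^ r = D := by group
    have hgD : D ^ r * (s * t.prod) * D ^ (-r) = g * D ^ (-r) := by
      rw [hg, List.prod_cons]
    have hgD' : D ^ (-r) * (g * D ^ (-r)) * D ^ r = s * t.prod := by
      rw [← hgD]; group
    -- Conjugation by `D^r` takes `s₁⋯s_k` to `g D^{-r}` and fixes `D`, so it takes the gcd `s₁` to
    -- the meet `m`.
    have hms : m = D ^ r * s * D ^ (-r) := by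
      refine ax.antisymm ?_ (hm _ ?_ ?_)
      · have hmQ : m ∈ Q := by
          refine one_leL_iff.1 (hm 1 ?_ (one_leL_iff.2 ax.garside_mem))
          rw [← hgD]
          have := htr (h1.2.1)
          refine LeL.trans ?_ this
          have := htr (one_leL_iff.2 h1.1)
          simpa using this
        have h2 : LeL Q (D ^ (-r) * m * D ^ r) s := by
          refine h1.2.2.2 _ (ax.conj_zpow_mem r hmQ) ?_ ?_
          · have := htr' hmg
            rwa [hgD'] at this
          · have := htr' hmD
            rwa [hDr'] at this
        have h3 := htr h2
        have h4 : D ^ r * (D ^ (-r) * m * D ^ r) * D ^ (-r) = m := by group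
        rwa [h4] at h3
      · have := htr h1.2.1
        rwa [hgD] at this
      · have := htr h1.2.2.1
        rwa [hDr] at this
    have htau : (tau D ^ (-r)) s = D ^ r * s * D ^ (-r) := by
      rw [tau, ← map_zpow, MulAut.conj_apply]
      simp
    rw [cycleList, htau, ← hms, hg, hms, List.prod_cons]
    group

theorem cycling_mem_superSummitSet (ax : IsGarsideGroup Q D) (hD : D ≠ 1) {g h : H}
    (hh : h ∈ superSummitSet Q D g) : cycling Q D h ∈ superSummitSet Q D g := by
  obtain ⟨m, h1, h2, h3⟩ := ax.exists_inf (h * D ^ (-inf Q D h)) D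
  rw [ax.cycling_eq_conj hD h1 h2 h3]
  rw [ax.mem_superSummitSet_iff hD] at hh ⊢
  obtain ⟨hc, hi, hs⟩ := hh
  -- Both elements whose meet is `m` conjugate `h` as powers of `D` do, so they preserve the bounds;
  -- convexity passes this to `m`.
  have e1 : (h * D ^ (-inf Q D h))⁻¹ * h * (h * D ^ (-inf Q D h))
      = (D ^ (-inf Q D h))⁻¹ * h * D ^ (-inf Q D h) := by group
  have e2 : D⁻¹ * h * D = (D ^ (1 : ℤ))⁻¹ * h * D ^ (1 : ℤ) := by simp
  refine ⟨hc.trans (isConj_conj h m), ?_, ?_⟩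
  · refine ax.zpow_leL_conj_meet ?_ ?_ h1 h2 h3
    · rwa [e1, ax.conj_zpow_leL]
    · rwa [e2, ax.conj_zpow_leL]
  · refine ax.conj_meet_leL_zpow ?_ ?_ h1 h2 h3
    · rwa [e1, ax.leL_conj_zpow]
    · rwa [e2, ax.leL_conj_zpow]

/-! ### Symmetric elements of ultra summit sets -/

section Symmetry

variable {σ : MulAut H}

theorem leL_map_iff (hσQ : ∀ a, σ a ∈ Q ↔ a ∈ Q) {a b : H} :
    LeL Q (σ a) (σ b) ↔ LeL Q a b := by
  rw [leL_iff, leL_iff, ← map_inv, ← map_mul, hσQ]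

theorem leL_map_left_iff (hσQ : ∀ a, σ a ∈ Q ↔ a ∈ Q) {a b : H} :
    LeL Q (σ a) b ↔ LeL Q a (σ⁻¹ b) := by
  rw [← leL_map_iff hσQ (a := a), MulAut.apply_inv_self]

theorem map_meet_eq (ax : IsGarsideGroup Q D) (hσQ : ∀ a, σ a ∈ Q ↔ a ∈ Q) {a b m : H}
    (ha : σ a = a) (hb : σ b = b) (hma : LeL Q m a) (hmb : LeL Q m b)
    (hm : ∀ c, LeL Q c a → LeL Q c b → LeL Q c m) : σ m = m := by
  refine ax.antisymm (hm _ ?_ ?_) ?_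
  · rwa [← ha, leL_map_iff hσQ]
  · rwa [← hb, leL_map_iff hσQ]
  · have h : LeL Q (σ⁻¹ m) m := by
      refine hm _ ?_ ?_
      · rwa [← leL_map_iff hσQ, MulAut.apply_inv_self, ha]
      · rwa [← leL_map_iff hσQ, MulAut.apply_inv_self, hb]
    rwa [← leL_map_iff hσQ, MulAut.apply_inv_self] at h

theorem cycling_map_eq (ax : IsGarsideGroup Q D) (hD : D ≠ 1) (hσQ : ∀ a, σ a ∈ Q ↔ a ∈ Q)
    (hσD : σ D = D) {h : H} (hh : σ h = h) : σ (cycling Q D h) = cycling Q D h := by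
  obtain ⟨m, h1, h2, h3⟩ := ax.exists_inf (h * D ^ (-inf Q D h)) D
  rw [ax.cycling_eq_conj hD h1 h2 h3]
  have hm : σ m = m := ax.map_meet_eq hσQ (by simp [hh, hσD]) hσD h1 h2 h3
  simp [hm, hh]

theorem exists_symmetric_mem_superSummitSet (ax : IsGarsideGroup Q D) (hD : D ≠ 1)
    (hσQ : ∀ a, σ a ∈ Q ↔ a ∈ Q) (hσD : σ D = D) {g X : H} (hg : IsConj g X) (hX : σ X = X) :
    ∃ Y ∈ superSummitSet Q D g, σ Y = Y := by
  let S : Set H := {a | a ∈ Q ∧ LeL Q (D ^ infS Q D g) (a⁻¹ * X * a) ∧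
    LeL Q (a⁻¹ * X * a) (D ^ supS Q D g)}
  have hS : S.Nonempty := by
    obtain ⟨Y, hY⟩ := ax.superSummitSet_nonempty hD g
    rw [ax.mem_superSummitSet_iff hD] at hY
    obtain ⟨a, haQ, h1, h2⟩ := ax.exists_pos_conj (hg.symm.trans hY.1)
    exact ⟨a, haQ, (h1 _).2 hY.2.1, (h2 _).2 hY.2.2⟩
  obtain ⟨a, ha, hmin⟩ := ax.exists_least hS (fun a ha => ha.1) (by
    intro a ha b hb m hma hmb hm
    refine ⟨one_leL_iff.1 (hm 1 (one_leL_iff.2 ha.1) (one_leL_iff.2 hb.1)), ?_, ?_⟩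
    · exact ax.zpow_leL_conj_meet ha.2.1 hb.2.1 hma hmb hm
    · exact ax.conj_meet_leL_zpow ha.2.2 hb.2.2 hma hmb hm)
  have hconj : ∀ b, (σ b)⁻¹ * X * σ b = σ (b⁻¹ * X * b) := fun b => by simp [hX]
  have hσS : ∀ b, σ b ∈ S ↔ b ∈ S := by
    intro b
    have h1 : ∀ r : ℤ, D ^ r = σ (D ^ r) := fun r => by simp [hσD]
    change _ ∧ _ ∧ _ ↔ _ ∧ _ ∧ _
    rw [hσQ, hconj]
    conv_lhs => rw [h1 (infS Q D g), h1 (supS Q D g), leL_map_iff hσQ, leL_map_iff hσQ]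
  have hσa : σ a = a := by
    refine ax.antisymm ?_ (hmin _ ((hσS a).2 ha))
    rw [leL_map_left_iff hσQ]
    refine hmin _ ((hσS _).1 ?_)
    rwa [MulAut.apply_inv_self]
  refine ⟨a⁻¹ * X * a, (ax.mem_superSummitSet_iff hD).2
    ⟨hg.trans (isConj_conj X a), ha.2.1, ha.2.2⟩, ?_⟩
  rw [← hconj, hσa]

/-- If an automorphism of the Garside structure fixes a conjugate of `g`, then it fixes an
element of the ultra summit set of `g`. -/
theorem exists_symmetric_mem_ultraSummitSet (ax : IsGarsideGroup Q D) (hD : D ≠ 1)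
    (hσQ : ∀ a, σ a ∈ Q ↔ a ∈ Q) (hσD : σ D = D) {g X : H} (hg : IsConj g X) (hX : σ X = X) :
    ∃ Y ∈ ultraSummitSet Q D g, σ Y = Y := by
  obtain ⟨Y, hY, hσY⟩ := ax.exists_symmetric_mem_superSummitSet hD hσQ hσD hg hX
  have hiter : ∀ k : ℕ, (cycling Q D)^[k] Y ∈ superSummitSet Q D g ∧
      σ ((cycling Q D)^[k] Y) = (cycling Q D)^[k] Y := by
    intro k
    induction k with
    | zero => exact ⟨hY, hσY⟩
    | succ k ih =>
      rw [Function.iterate_succ_apply']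
      exact ⟨ax.cycling_mem_superSummitSet hD ih.1, ax.cycling_map_eq hD hσQ hσD ih.2⟩
  -- The iterates stay in a finite set, so two of them coincide.
  obtain ⟨i, -, j, -, hij, he⟩ := Set.infinite_univ.exists_lt_map_eq_of_mapsTo
    (f := fun k : ℕ => (cycling Q D)^[k] Y) (fun k _ => (hiter k).1)
    (ax.finite_superSummitSet hD g)
  refine ⟨(cycling Q D)^[i] Y, ⟨(hiter i).1, j - i, by omega, ?_⟩, (hiter i).2⟩
  rw [← Function.iterate_add_apply, Nat.sub_add_cancel hij.le]
  exact he.symm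

end Symmetry

end IsGarsideGroup

end Axioms

/-! ### From a Garside monoid to its group of fractions -/

section MonoidToGroup

variable {G : Type*} [Group G] {P : Submonoid G}

theorem IsMonoidAtom.mem_of_mem_closure {M : Type*} [Monoid M] {S : Set M} {a : M}
    (ha : IsMonoidAtom a) (h : a ∈ Submonoid.closure S) : a ∈ S := by
  induction h using Submonoid.closure_induction with
  | mem x hx => exact hx
  | one => exact absurd rfl ha.1
  | mul x y _ _ ihx ihy =>
    rcases ha.2 x y rfl with rfl | rfl
    · rw [one_mul] at ha ⊢
      exact ihy ha
    · rw [mul_one] at ha ⊢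
      exact ihx ha

theorem finite_isMonoidAtom {M : Type*} [Monoid M] (h : Monoid.FG M) :
    {a : M | IsMonoidAtom a}.Finite := by
  obtain ⟨S, hS⟩ := h.fg_top
  refine S.finite_toSet.subset fun a ha => ha.mem_of_mem_closure ?_
  rw [hS]
  trivial

/-- An atom word of a divisor extends to one of `b`, so its length is bounded; and the atoms are
finite in number, as each lies in every generating set. -/
theorem finite_monLeL {M : Type*} [Monoid M] (hM : IsAtomicMonoid M) (hfg : Monoid.FG M)
    (b : M) : {a : M | MonLeL a b}.Finite := by
  obtain ⟨N, hN⟩ := hM.2 b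
  have hl : ∀ x : M, ∃ l : List M, (∀ s ∈ l, IsMonoidAtom s) ∧ l.prod = x := fun x =>
    Submonoid.exists_list_of_mem_closure (hM.1 ▸ Submonoid.mem_top x)
  have : Finite {a : M | IsMonoidAtom a} := finite_isMonoidAtom hfg
  refine ((List.finite_length_le {a : M | IsMonoidAtom a} N).image
    fun l => (l.map Subtype.val).prod).subset ?_
  rintro a ⟨c, rfl⟩
  obtain ⟨l₁, h₁, rfl⟩ := hl a
  obtain ⟨l₂, h₂, rfl⟩ := hl c
  have hlen := hN (l₁ ++ l₂) (fun s hs => (List.mem_append.1 hs).elim (h₁ s) (h₂ s))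
    (List.prod_append)
  rw [List.length_append] at hlen
  lift l₁ to List {a : M | IsMonoidAtom a} using h₁
  refine ⟨l₁, ?_, rfl⟩
  simp only [List.length_map] at hlen
  change l₁.length ≤ N
  omega

theorem monLeL_iff_leL {a b : P} : MonLeL a b ↔ LeL P (a : G) b := by
  constructor
  · rintro ⟨c, rfl⟩
    exact leL_mul_right c.2
  · rintro ⟨c, hc, h⟩
    exact ⟨⟨c, hc⟩, Subtype.ext h⟩

theorem IsGarsideElement.coe_induction {Δ : P} (hΔ : IsGarsideElement Δ) {p : G → Prop}
    (mem : ∀ s t : G, s ∈ P → t ∈ P → s * t = Δ → p s) (one : p 1)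
    (mul : ∀ x y : G, x ∈ P → y ∈ P → p x → p y → p (x * y)) {a : G} (ha : a ∈ P) : p a := by
  have key : ∀ a : P, p a := by
    intro a
    have h : a ∈ Submonoid.closure {b : P | MonLeL b Δ} := hΔ.2 ▸ Submonoid.mem_top a
    induction h using Submonoid.closure_induction with
    | mem x hx =>
      obtain ⟨t, ht⟩ := hx
      exact mem x t x.2 t.2 (congrArg Subtype.val ht)
    | one => exact one
    | mul x y _ _ ihx ihy => exact mul x y x.2 y.2 ihx ihy
  exact key ⟨a, ha⟩

theorem IsGarsideElement.conj_mem {Δ : P} (hΔ : IsGarsideElement Δ) {a : G} (ha : a ∈ P) :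
    (Δ : G)⁻¹ * a * Δ ∈ P := by
  refine hΔ.coe_induction (p := fun a => (Δ : G)⁻¹ * a * Δ ∈ P) ?_ ?_ ?_ ha
  · intro s t hs ht hst
    have h1 : MonLeR (⟨t, ht⟩ : P) Δ := ⟨⟨s, hs⟩, Subtype.ext hst⟩
    have h2 : (⟨t, ht⟩ : P) ∈ {b : P | MonLeL b Δ} := hΔ.1 ▸ h1
    obtain ⟨u, hu⟩ := h2
    have hu' : t * u = (Δ : G) := congrArg Subtype.val hu
    -- From `Δ = s t = t u` follows `s Δ = s t u = Δ u`.
    have h3 : (Δ : G)⁻¹ * s * Δ = u := by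
      nth_rewrite 2 [← hu']
      rw [← hst]
      group
    rw [h3]
    exact u.2
  · simp [P.one_mem]
  · intro x y _ _ hx hy
    have := P.mul_mem hx hy
    simpa [mul_assoc] using this

theorem IsGarsideElement.conj_inv_mem {Δ : P} (hΔ : IsGarsideElement Δ) {a : G} (ha : a ∈ P) :
    (Δ : G) * a * (Δ : G)⁻¹ ∈ P := by
  refine hΔ.coe_induction (p := fun a => (Δ : G) * a * (Δ : G)⁻¹ ∈ P) ?_ ?_ ?_ ha
  · intro s t hs ht hst
    have h1 : MonLeL (⟨s, hs⟩ : P) Δ := ⟨⟨t, ht⟩, Subtype.ext hst⟩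
    have h2 : (⟨s, hs⟩ : P) ∈ {b : P | MonLeR b Δ} := hΔ.1 ▸ h1
    obtain ⟨u, hu⟩ := h2
    have hu' : u * s = (Δ : G) := congrArg Subtype.val hu
    obtain ⟨v, hv⟩ : (u : P) ∈ {b : P | MonLeR b Δ} := hΔ.1 ▸ (⟨⟨s, hs⟩, hu⟩ : MonLeL u Δ)
    have hv' : v * u = (Δ : G) := congrArg Subtype.val hv
    have h3 : (Δ : G) * s * (Δ : G)⁻¹ = v := by
      nth_rewrite 1 [← hv']
      rw [← hu']
      group
    rw [h3]
    exact v.2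
  · simp [P.one_mem]
  · intro x y _ _ hx hy
    have := P.mul_mem hx hy
    simpa [mul_assoc] using this

theorem IsGarsideElement.conj_pow_mem {Δ : P} (hΔ : IsGarsideElement Δ) (k : ℕ) {a : G}
    (ha : a ∈ P) : ((Δ : G) ^ k)⁻¹ * a * (Δ : G) ^ k ∈ P := by
  induction k with
  | zero => simpa using ha
  | succ k ih => simpa [pow_succ, mul_assoc] using hΔ.conj_mem ih

theorem IsGarsideElement.conj_inv_pow_mem {Δ : P} (hΔ : IsGarsideElement Δ) (k : ℕ) {a : G}
    (ha : a ∈ P) : (Δ : G) ^ k * a * ((Δ : G) ^ k)⁻¹ ∈ P := by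
  induction k with
  | zero => simpa using ha
  | succ k ih => simpa [pow_succ', mul_assoc] using hΔ.conj_inv_mem ih

theorem IsGarsideElement.exists_leL_pow {Δ : P} (hΔ : IsGarsideElement Δ) {a : G}
    (ha : a ∈ P) : ∃ k : ℕ, LeL P a ((Δ : G) ^ k) := by
  refine hΔ.coe_induction (p := fun a => ∃ k : ℕ, LeL P a ((Δ : G) ^ k)) ?_ ?_ ?_ ha
  · rintro s t _ ht hst
    exact ⟨1, t, ht, by simpa using hst⟩
  · exact ⟨0, by simpa using leL_refl (1 : G)⟩
  · rintro x y - - ⟨j, hj⟩ ⟨k, hk⟩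
    refine ⟨j + k, ((leL_mul_left_iff x).2 hk).trans ?_⟩
    rw [leL_iff] at hj ⊢
    simpa [pow_add, mul_assoc] using hΔ.conj_pow_mem k hj

theorem IsGarsideElement.exists_pow_mul_mem {Δ : P} (hΔ : IsGarsideElement Δ)
    (hG : IsGroupOfFractions P) (g : G) : ∃ k : ℕ, ∀ j, k ≤ j → (Δ : G) ^ j * g ∈ P := by
  obtain ⟨a, ha, b, hb, rfl⟩ := hG g
  obtain ⟨k, c, hc, hk⟩ := hΔ.exists_leL_pow hb
  refine ⟨k, fun j hj => ?_⟩
  have h1 : (Δ : G) ^ k * (a * b⁻¹) = (Δ : G) ^ k * (a * c) * ((Δ : G) ^ k)⁻¹ := by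
    have h2 : b⁻¹ = c * ((Δ : G) ^ k)⁻¹ := by
      rw [← hk]
      group
    rw [h2]
    group
  rw [← Nat.sub_add_cancel hj, pow_add, mul_assoc, h1]
  exact P.mul_mem (P.pow_mem Δ.2 _) (hΔ.conj_inv_pow_mem k (P.mul_mem ha hc))

/-- A greatest common divisor in the positive monoid is a meet in the group. -/
theorem IsGarsideElement.leL_of_monoid_meet {Δ : P} (hΔ : IsGarsideElement Δ)
    (hP : IsGarsideMonoid P) (hG : IsGroupOfFractions P) {u v m : P}
    (hmu : MonLeL m u) (hmv : MonLeL m v) (hm : ∀ c, MonLeL c u → MonLeL c v → MonLeL c m)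
    {c : G} (hcu : LeL P c u) (hcv : LeL P c v) : LeL P c m := by
  obtain ⟨k, hk⟩ := hΔ.exists_pow_mul_mem hG c
  have hc := hk k le_rfl
  -- Since `c` need not be positive, everything is shifted by `Δ^k`. The shifted meet is `w = Δ^k m
  -- z`; as `m z` divides `u` and `v`, it divides `m`, so `Δ^k c ≤_L w ≤_L Δ^k m`.
  obtain ⟨w, hwu, hwv, hw⟩ := hP.lattice_left.exists_inf (Δ ^ k * u) (Δ ^ k * v)
  have hcw : MonLeL (⟨_, hc⟩ : P) w := by
    refine hw _ ?_ ?_ <;> rw [monLeL_iff_leL]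
    · simpa using (leL_mul_left_iff ((Δ : G) ^ k)).2 hcu
    · simpa using (leL_mul_left_iff ((Δ : G) ^ k)).2 hcv
  obtain ⟨z, hz⟩ : MonLeL (Δ ^ k * m) w := by
    refine hw _ ?_ ?_ <;> rw [monLeL_iff_leL] at *
    · simpa using (leL_mul_left_iff ((Δ : G) ^ k)).2 hmu
    · simpa using (leL_mul_left_iff ((Δ : G) ^ k)).2 hmv
  have hmz : MonLeL (m * z) m := by
    refine hm _ ?_ ?_ <;> rw [monLeL_iff_leL] at *
    · rw [← hz] at hwu
      rw [← leL_mul_left_iff ((Δ : G) ^ k)]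
      simpa [mul_assoc] using hwu
    · rw [← hz] at hwv
      rw [← leL_mul_left_iff ((Δ : G) ^ k)]
      simpa [mul_assoc] using hwv
  rw [monLeL_iff_leL] at hcw hmz
  rw [← leL_mul_left_iff ((Δ : G) ^ k)] at hmz ⊢
  refine hcw.trans ?_
  rw [← hz]
  simpa [mul_assoc] using hmz

theorem IsGarsideElement.isGarsideGroup {Δ : P} (hΔ : IsGarsideElement Δ)
    (hP : IsGarsideMonoid P) (hG : IsGroupOfFractions P) : IsGarsideGroup P (Δ : G) where
  eq_one_of_mem a ha ha' := by
    have := hP.lattice_left.antisymm ⟨a, ha⟩ 1 ⟨⟨a⁻¹, ha'⟩, Subtype.ext (by simp)⟩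
      ⟨⟨a, ha⟩, by simp⟩
    exact congrArg Subtype.val this
  garside_mem := Δ.2
  conj_mem _ := hΔ.conj_mem
  conj_inv_mem _ := hΔ.conj_inv_mem
  exists_inf a b := by
    obtain ⟨i, hi⟩ := hΔ.exists_pow_mul_mem hG a
    obtain ⟨j, hj⟩ := hΔ.exists_pow_mul_mem hG b
    have ha := hi (i + j) (by omega)
    have hb := hj (i + j) (by omega)
    obtain ⟨m, h1, h2, h3⟩ := hP.lattice_left.exists_inf ⟨_, ha⟩ ⟨_, hb⟩
    refine ⟨((Δ : G) ^ (i + j))⁻¹ * m, ?_, ?_, fun c hca hcb => ?_⟩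
    · rw [← leL_mul_left_iff ((Δ : G) ^ (i + j)), mul_inv_cancel_left]
      exact monLeL_iff_leL.1 h1
    · rw [← leL_mul_left_iff ((Δ : G) ^ (i + j)), mul_inv_cancel_left]
      exact monLeL_iff_leL.1 h2
    · rw [← leL_mul_left_iff ((Δ : G) ^ (i + j)), mul_inv_cancel_left]
      exact hΔ.leL_of_monoid_meet hP hG h1 h2 h3 ((leL_mul_left_iff _).2 hca)
        ((leL_mul_left_iff _).2 hcb)
  exists_sup a b := by
    obtain ⟨i, hi⟩ := hΔ.exists_pow_mul_mem hG a
    obtain ⟨j, hj⟩ := hΔ.exists_pow_mul_mem hG b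
    have ha := hi (i + j) (by omega)
    have hb := hj (i + j) (by omega)
    obtain ⟨m, h1, h2, h3⟩ := hP.lattice_left.exists_sup ⟨_, ha⟩ ⟨_, hb⟩
    refine ⟨((Δ : G) ^ (i + j))⁻¹ * m, ?_, ?_, fun c hca hcb => ?_⟩
    · rw [← leL_mul_left_iff ((Δ : G) ^ (i + j)), mul_inv_cancel_left]
      exact monLeL_iff_leL.1 h1
    · rw [← leL_mul_left_iff ((Δ : G) ^ (i + j)), mul_inv_cancel_left]
      exact monLeL_iff_leL.1 h2
    · rw [← leL_mul_left_iff ((Δ : G) ^ (i + j))] at hca hcb ⊢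
      rw [mul_inv_cancel_left]
      -- Upper bounds of positive elements are positive, so monoid joins are group joins with no
      -- further shift.
      have := h3 ⟨_, hca.mem ha⟩ (monLeL_iff_leL.2 hca) (monLeL_iff_leL.2 hcb)
      exact monLeL_iff_leL.1 this
  exists_le_pow g := by
    obtain ⟨a, ha, b, hb, rfl⟩ := hG g
    obtain ⟨k, hk⟩ := hΔ.exists_leL_pow ha
    obtain ⟨j, hj⟩ := hΔ.exists_pow_mul_mem hG b
    refine ⟨k + j, ?_⟩
    have h1 : LeL P (b⁻¹) ((Δ : G) ^ j) := by
      rw [leL_iff, inv_inv]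
      have := hΔ.conj_pow_mem j (hj j le_rfl)
      simpa [mul_assoc] using this
    refine ((leL_mul_left_iff a).2 h1).trans ?_
    rw [leL_iff] at hk ⊢
    simpa [pow_add, mul_assoc] using hΔ.conj_pow_mem j hk
  finite_le_pow k := by
    refine ((finite_monLeL hP.atomic hP.fg (Δ ^ k)).image Subtype.val).subset ?_
    rintro a ⟨ha, hak⟩
    exact ⟨⟨a, ha⟩, monLeL_iff_leL.2 (by simpa using hak), rfl⟩

end MonoidToGroup

/-! ### The Garside structure of `G(n)` and conjugacy to `δ(h,…,h)` -/

namespace CyclicPower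

variable {n : ℕ} {G : Type*} [Group G] {P : Submonoid G}

@[simp] theorem exp_mul (a b : CyclicPower n G) : (a * b).exp = a.exp + b.exp := rfl

@[simp] theorem coord_mul (a b : CyclicPower n G) :
    (a * b).coord = rot b.exp a.coord * b.coord := rfl

@[simp] theorem exp_inv (a : CyclicPower n G) : a⁻¹.exp = -a.exp := rfl

@[simp] theorem coord_inv (a : CyclicPower n G) : a⁻¹.coord = rot (-a.exp) (a.coord)⁻¹ := rfl

theorem rot_rot {α : Type*} (k m : ℤ) (x : Fin n → α) : rot k (rot m x) = rot (k + m) x := by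
  funext i
  simp only [rot]
  rw [← Equiv.Perm.mul_apply, ← zpow_add, neg_add, add_comm]

@[simp] theorem rot_zero {α : Type*} (x : Fin n → α) : rot 0 x = x := by
  funext i
  simp [rot]

theorem rot_mul (k : ℤ) (x y : Fin n → G) : rot k (x * y) = rot k x * rot k y := rfl

theorem rot_inv (k : ℤ) (x : Fin n → G) : rot k x⁻¹ = (rot k x)⁻¹ := rfl

@[simp] theorem rot_const {α : Type*} (k : ℤ) (h : α) : rot k (fun _ : Fin n => h) = fun _ => h := rfl

theorem rot_mem_iff {k : ℤ} {x : Fin n → G} : (∀ i, rot k x i ∈ P) ↔ ∀ i, x i ∈ P := by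
  refine ⟨fun h i => ?_, fun h i => h _⟩
  have := h ((finRotate n ^ k) i)
  rwa [rot, ← Equiv.Perm.mul_apply, ← zpow_add, neg_add_cancel, zpow_zero] at this

/-- The coordinates of `a = x δ^k` with the power of `δ` written on the right. -/
def leftCoord {α : Type*} (a : CyclicPower n α) : Fin n → α := rot (-a.exp) a.coord

/-- The element `x δ^k`. -/
def ofLeft {α : Type*} (k : ℤ) (x : Fin n → α) : CyclicPower n α := ⟨k, rot k x⟩

@[simp] theorem exp_ofLeft {α : Type*} (k : ℤ) (x : Fin n → α) : (ofLeft k x).exp = k := rfl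

@[simp] theorem leftCoord_ofLeft {α : Type*} (k : ℤ) (x : Fin n → α) : leftCoord (ofLeft k x) = x := by
  simp [leftCoord, ofLeft, rot_rot]

theorem ext_leftCoord {α : Type*} {a b : CyclicPower n α} (h1 : a.exp = b.exp)
    (h2 : leftCoord a = leftCoord b) : a = b := by
  have h3 := congrArg (rot a.exp) h2
  simp only [leftCoord, ← h1, rot_rot, add_neg_cancel, rot_zero] at h3
  exact CyclicPower.ext h1 h3

/-- With `δ^k` on the right, the rotations in `a⁻¹ b` act on all coordinates alike, so the order is
a product order; meets, joins and finiteness are then coordinatewise. -/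
theorem leL_positive_iff {a b : CyclicPower n G} :
    LeL (positive P n) a b ↔
      a.exp ≤ b.exp ∧ ∀ i, LeL P (leftCoord a i) (leftCoord b i) := by
  rw [leL_iff]
  change (0 ≤ -a.exp + b.exp ∧ ∀ i, (rot b.exp (rot (-a.exp) a.coord⁻¹) * b.coord) i ∈ P) ↔ _
  refine and_congr (by omega) ?_
  rw [← rot_mem_iff (k := -b.exp)]
  simp [leL_iff, leftCoord, rot_mul, rot_rot, rot_inv]

theorem mem_positive_iff {a : CyclicPower n G} :
    a ∈ positive P n ↔ 0 ≤ a.exp ∧ ∀ i, leftCoord a i ∈ P := by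
  rw [leftCoord, rot_mem_iff]
  rfl

theorem deltaConst_pow (h : G) (k : ℕ) :
    (deltaConst n h) ^ k = ⟨k, fun _ => h ^ k⟩ := by
  induction k with
  | zero => simp [one_def]; rfl
  | succ k ih =>
    rw [pow_succ, ih]
    ext i
    · simp [deltaConst]
    · simp [deltaConst, pow_succ]

theorem isGarsideGroup {Δ : G} (ax : IsGarsideGroup P Δ) :
    IsGarsideGroup (positive P n) (deltaConst n Δ) where
  eq_one_of_mem a ha ha' := by
    have h1 : 0 ≤ a.exp := ha.1
    have h2 : 0 ≤ -a.exp := ha'.1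
    have h0 : a.exp = 0 := by omega
    refine CyclicPower.ext h0 (funext fun i => ax.eq_one_of_mem _ (ha.2 i) ?_)
    have := ha'.2 i
    simpa [h0] using this
  garside_mem := ⟨zero_le_one, fun _ => ax.garside_mem⟩
  conj_mem a ha := by
    refine ⟨?_, fun i => ?_⟩
    · have := ha.1
      simpa [deltaConst] using this
    · have := ax.conj_mem _ (ha.2 ((finRotate n ^ (-1 : ℤ)) i))
      simpa [deltaConst, rot] using this
  conj_inv_mem a ha := by
    refine ⟨?_, fun i => ?_⟩
    · have := ha.1
      simpa [deltaConst] using this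
    · have := ax.conj_inv_mem _ (ha.2 ((finRotate n ^ (1 : ℤ)) i))
      simpa [deltaConst, rot] using this
  exists_inf a b := by
    choose m h1 h2 h3 using fun i => ax.exists_inf (leftCoord a i) (leftCoord b i)
    refine ⟨ofLeft (min a.exp b.exp) m, ?_, ?_, fun c hca hcb => ?_⟩
    · exact leL_positive_iff.2 ⟨min_le_left _ _, by simpa using h1⟩
    · exact leL_positive_iff.2 ⟨min_le_right _ _, by simpa using h2⟩
    · rw [leL_positive_iff] at *
      exact ⟨le_min hca.1 hcb.1, by simpa using fun i => h3 i _ (hca.2 i) (hcb.2 i)⟩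
  exists_sup a b := by
    choose m h1 h2 h3 using fun i => ax.exists_sup (leftCoord a i) (leftCoord b i)
    refine ⟨ofLeft (max a.exp b.exp) m, ?_, ?_, fun c hca hcb => ?_⟩
    · exact leL_positive_iff.2 ⟨le_max_left _ _, by simpa using h1⟩
    · exact leL_positive_iff.2 ⟨le_max_right _ _, by simpa using h2⟩
    · rw [leL_positive_iff] at *
      exact ⟨max_le hca.1 hcb.1, by simpa using fun i => h3 i _ (hca.2 i) (hcb.2 i)⟩
  exists_le_pow a := by
    choose k hk using fun i => ax.exists_le_pow (leftCoord a i)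
    refine ⟨a.exp.toNat + ∑ i, k i, ?_⟩
    rw [leL_positive_iff, deltaConst_pow]
    refine ⟨by simp only [Nat.cast_add]; omega, fun i => (hk i).trans ?_⟩
    have h1 : k i ≤ a.exp.toNat + ∑ i, k i :=
      (Finset.single_le_sum (fun _ _ => Nat.zero_le _) (Finset.mem_univ i)).trans
        (Nat.le_add_left _ _)
    have h2 := ax.zpow_leL_zpow (r := k i)
      (s := (a.exp.toNat + ∑ i, k i : ℕ)) (by exact_mod_cast h1)
    rw [zpow_natCast, zpow_natCast] at h2
    exact h2
  finite_le_pow k := by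
    have hfin : ((Set.Icc (0 : ℤ) k) ×ˢ
        Set.pi Set.univ fun _ : Fin n => {a : G | a ∈ P ∧ LeL P a (Δ ^ k)}).Finite :=
      (Set.finite_Icc _ _).prod (Set.Finite.pi fun _ => ax.finite_le_pow k)
    refine Set.Finite.of_injOn (f := fun a => (a.exp, leftCoord a)) ?_ ?_ hfin
    · rintro a ⟨h1, h2⟩
      rw [mem_positive_iff] at h1
      rw [deltaConst_pow, leL_positive_iff] at h2
      exact ⟨⟨h1.1, h2.1⟩, fun i _ => ⟨h1.2 i, h2.2 i⟩⟩
    · intro a _ b _ hab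
      simp only [Prod.mk.injEq] at hab
      exact ext_leftCoord hab.1 hab.2

theorem deltaConst_ne_one (h : G) : deltaConst n h ≠ 1 := fun e =>
  one_ne_zero (congrArg CyclicPower.exp e)

theorem exp_eq_of_isConj {a b : CyclicPower n G} (h : IsConj a b) : a.exp = b.exp := by
  obtain ⟨c, rfl⟩ := isConj_iff.1 h
  simp

/-- Conjugation by `δ`, which rotates the coordinates. -/
def rotAut (n : ℕ) (G : Type*) [Group G] : MulAut (CyclicPower n G) :=
  MulAut.conj (deltaConst n (1 : G))⁻¹

theorem rotAut_apply (a : CyclicPower n G) : rotAut n G a = ⟨a.exp, rot 1 a.coord⟩ := by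
  rw [rotAut, MulAut.conj_apply, inv_inv]
  ext i
  · simp [deltaConst]
  · simp [deltaConst, rot]

theorem rotAut_mem_positive_iff (a : CyclicPower n G) :
    rotAut n G a ∈ positive P n ↔ a ∈ positive P n := by
  rw [rotAut_apply]
  exact and_congr Iff.rfl rot_mem_iff

theorem coord_eq_coord_zero_of_rot_one_eq {α : Type*} {n : ℕ} {x : Fin (n + 1) → α} (h : rot 1 x = x)
    (i : Fin (n + 1)) : x i = x 0 := by
  induction i using Fin.induction with
  | zero => rfl
  | succ i ih =>
    rw [← ih]
    have h1 := congrFun h i.succ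
    rw [← h1, rot, zpow_neg_one]
    congr 1
    rw [Equiv.Perm.inv_eq_iff_eq, finRotate_apply]
    simp

/-- Comparison of coordinates in `γ δ(g, 1, …, 1) = δ(h, …, h) γ`. -/
theorem mul_deltaFirst_eq_iff {n : ℕ} (g h : G) (k : ℤ) (x : Fin (n + 1) → G) :
    (⟨k, x⟩ : CyclicPower (n + 1) G) * deltaFirst (n + 1) g = deltaConst (n + 1) h * ⟨k, x⟩ ↔
      x (Fin.last n) * g = h * x 0 ∧ ∀ i : Fin n, x i.castSucc = h * x i.succ := by
  have h1 : (finRotate (n + 1) ^ (-1 : ℤ)) 0 = Fin.last n := by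
    rw [zpow_neg_one, Equiv.Perm.inv_eq_iff_eq, finRotate_last]
  have h2 : ∀ i : Fin n, (finRotate (n + 1) ^ (-1 : ℤ)) i.succ = i.castSucc := by
    intro i
    rw [zpow_neg_one, Equiv.Perm.inv_eq_iff_eq, finRotate_apply]
    simp
  rw [CyclicPower.ext_iff, funext_iff, Fin.forall_fin_succ]
  have h3 : ∀ i, rot 1 x i = x ((finRotate (n + 1) ^ (-1 : ℤ)) i) := fun _ => rfl
  simp only [exp_mul, coord_mul, Pi.mul_apply]
  simp only [deltaConst, deltaFirst, h3, h1, h2, rot_const]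
  simp [add_comm]

theorem coord_eq_pow_mul_last {n : ℕ} {h : G} {x : Fin (n + 1) → G}
    (hx : ∀ i : Fin n, x i.castSucc = h * x i.succ) :
    x 0 = h ^ n * x (Fin.last n) := by
  have key : ∀ i : Fin (n + 1), x 0 = h ^ (i : ℕ) * x i := by
    intro i
    induction i using Fin.induction with
    | zero => simp
    | succ i ih => rw [ih, hx i, Fin.val_succ, pow_succ, mul_assoc]; rfl
  simpa using key (Fin.last n)

theorem eq_conj_pow_of_deltaFirst_eq {n : ℕ} {g h : G} {k : ℤ} {x : Fin (n + 1) → G}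
    (e : deltaFirst (n + 1) g = (⟨k, x⟩ : CyclicPower (n + 1) G)⁻¹ * deltaConst (n + 1) h * ⟨k, x⟩) :
    g = ((x (Fin.last n))⁻¹ * h * x (Fin.last n)) ^ (n + 1) := by
  rw [mul_assoc, eq_inv_mul_iff_mul_eq, mul_deltaFirst_eq_iff] at e
  have h1 := conj_pow (a := (x (Fin.last n))⁻¹) (b := h) (i := n + 1)
  rw [inv_inv] at h1
  rw [h1, mul_assoc, eq_inv_mul_iff_mul_eq, e.1, coord_eq_pow_mul_last e.2, pow_succ', mul_assoc]

theorem isConj_deltaFirst_pow {n : ℕ} (x : G) :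
    IsConj (deltaFirst (n + 1) (x ^ (n + 1))) (deltaConst (n + 1) x) := by
  rw [isConj_iff]
  -- The recursion `x_i = x x_{i+1}` started from last coordinate `1`.
  refine ⟨⟨0, fun i => x ^ (n - i : ℕ)⟩, ?_⟩
  rw [mul_inv_eq_iff_eq_mul, mul_deltaFirst_eq_iff]
  refine ⟨by simp [pow_succ'], fun i => ?_⟩
  rw [← pow_succ']
  congr 1
  simp only [Fin.val_castSucc, Fin.val_succ]
  omega

end CyclicPower

end Garside

/-! ### The criterion for roots -/

open Garside in
theorem theorem8p2 {G : Type*} [Group G] (P : Submonoid G) (hP : IsGarsideMonoid P)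
    (hG : IsGroupOfFractions P) (Δ : P) (hΔ : IsGarsideElement Δ)
    (n : ℕ) (hn : 1 ≤ n) (g : G) :
    ((∃ x : G, x ^ n = g) ↔
      ∃ h : G, CyclicPower.deltaConst n h ∈
        ultraSummitSet (CyclicPower.positive P n) (CyclicPower.deltaConst n (Δ : G))
          (CyclicPower.deltaFirst n g)) ∧
    ∀ (h : G) (k : ℤ) (x : Fin n → G),
      CyclicPower.deltaFirst n g =
        (⟨k, x⟩ : CyclicPower n G)⁻¹ * CyclicPower.deltaConst n h * ⟨k, x⟩ →
      g = ((x ⟨n - 1, by omega⟩)⁻¹ * h * x ⟨n - 1, by omega⟩) ^ n := by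
  obtain ⟨n, rfl⟩ : ∃ m, n = m + 1 := ⟨n - 1, by omega⟩
  refine ⟨⟨?_, ?_⟩, fun h k x e => CyclicPower.eq_conj_pow_of_deltaFirst_eq e⟩
  · rintro ⟨x, rfl⟩
    have ax := CyclicPower.isGarsideGroup (n := n + 1) (hΔ.isGarsideGroup hP hG)
    have hσ : ∀ h : G, CyclicPower.rotAut (n + 1) G (CyclicPower.deltaConst (n + 1) h)
        = CyclicPower.deltaConst (n + 1) h := fun h => CyclicPower.rotAut_apply _
    obtain ⟨Y, hY, hσY⟩ := ax.exists_symmetric_mem_ultraSummitSet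
      (CyclicPower.deltaConst_ne_one _) CyclicPower.rotAut_mem_positive_iff (hσ _)
      (CyclicPower.isConj_deltaFirst_pow x) (hσ x)
    -- Conjugation preserves the exponent, so `Y` has exponent 1; being fixed by the rotation, it
    -- has equal coordinates.
    have hexp := CyclicPower.exp_eq_of_isConj hY.1.1
    rw [CyclicPower.rotAut_apply] at hσY
    have hc := CyclicPower.coord_eq_coord_zero_of_rot_one_eq (congrArg CyclicPower.coord hσY)
    refine ⟨Y.coord 0, ?_⟩
    convert hY using 1
    exact CyclicPower.ext hexp (funext fun i => (hc i).symm)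
  · rintro ⟨h, hh⟩
    obtain ⟨c, hc⟩ := isConj_iff.1 hh.1.1.symm
    exact ⟨_, (CyclicPower.eq_conj_pow_of_deltaFirst_eq (k := (c⁻¹).exp) (x := (c⁻¹).coord)
      (by rw [← hc]; change _ = (c⁻¹)⁻¹ * _ * c⁻¹; rw [inv_inv])).symm⟩
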